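/- Let $d\in\mathbb N$, $I_\pm=\{\pm1,\dots,\pm d\}$, and let $r:I_\pm\to\mathbb Z^d$ be any jump function. For a permutation $\pi$ of $I_\pm$ and phases $\Theta=(\theta_\sigma)_{\sigma\in I_\pm}$ let $C(\pi,\Theta)\in U(2d)$ be the phased permutation matrix with entries $C(\pi,\Theta)_{\sigma\tau}=e^{i\theta_\sigma}\delta_{\sigma,\pi(\tau)}$, and put $C(\pi)=C(\pi,0)$. Let $C_k=C(\pi_k,\Theta_k)$, $k\ge1$, be i.i.d. random matrices of this form on a probability space, let $\mu$ be the law of the permutation part $\pi_k$ (it does not depend on $k$), and let $$P(\sigma',\sigma)=\sum_{\pi}\mu(\pi)\,\delta_{\sigma,\pi(\sigma')},\qquad \sigma',\sigma\in I_\pm .$$ Let $\varphi_0=\sum_{\tau\in I_\pm}a_\tau|\tau\rangle\in\mathbb C^{2d}$ be a unit vector, let $\tau_0$ be an $I_\pm$-valued random variable with law $p_0(\tau)=|a_\tau|^2$, independent of the sequence $(C_k)_{k\ge1}$, and let $\tau_j=(\pi_j\pi_{j-1}\cdots\pi_1)(\tau_0)$, $j\ge0$, be the coin path. Assume that $P$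 is irreducible. Then: 1. $P$ is doubly stochastic, $P=\mathbb E(C(\pi_k)^T)$ for every $k\ge1$, and $(\tau_j)_{j\ge0}$ is a Markov chain with finite state space $I_\pm$, initial distribution $p_0$ and transition matrix $P$. 2. With $\bar r=\frac1{2d}\sum_{\tau\in I_\pm}r(\tau)$, $$\lim_{n\to\infty}\frac1n\sum_{j=1}^n r(\tau_j)=\bar r\quad\text{almost surely.}$$ 3. Let $u_0\in\mathbb R^{2d}$ have all components $\frac1{2d}$, let $Q=\mathbb I-2d\,|u_0\rangle\langle u_0|$ and $P_Q=QPQ$. Then $P_Q-\mathbb I$ is invertible. Let $S(1)=(P_Q-\mathbb I)^{-1}Q$ be the reduced resolvent of $P$ at $1$; it satisfies $(P-\mathbb I)S(1)=S(1)(P-\mathbb I)=Q$. With $r_i=(r(\tau)_i)_{\tau\in I_\pm}\in\mathbb R^{2d}$ for $1\le i\le d$, the matrix $$\Sigma_{ij}=-\frac1{2d}\langle r_i|r_j\rangle+\bar r_i\bar r_j-\frac1{2d}\bigl(\langle r_i|S(1)r_j\rangle+\langle r_j|S(1)r_i\rangle\bigr)$$ is positive semidefinite and, as $n\to\infty$,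 in distribution, $$\frac1{\sqrt n}\sum_{j=1}^n\bigl(r(\tau_j)-\bar r\bigr)\longrightarrow\mathcal N(0,\Sigma),$$ where $\mathcal N(0,\Sigma)$ is the centered, possibly degenerate, normal law on $\mathbb R^d$ with covariance matrix $\Sigma$. -/

import Mathlib

open MeasureTheory ProbabilityTheory Filter Topology Matrix

noncomputable section

namespace QuantumWalk

/-- The set `I_± = {±1, …, ±d}` of coin states. -/
abbrev CoinIndex (d : ℕ) : Type :=
  {z : ℤ // z ∈ (Finset.Icc (-(d : ℤ)) (d : ℤ)).erase 0}

/-- The Borel (product) σ-algebra on the coin matrices. -/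
instance coinMeasurableSpace (d : ℕ) :
    MeasurableSpace (Matrix (CoinIndex d) (CoinIndex d) ℂ) :=
  inferInstanceAs (MeasurableSpace (CoinIndex d → CoinIndex d → ℂ))

/-- The phased permutation matrix `C(π, Θ) = ∑_τ e^{i θ_{π(τ)}} |π(τ)⟩⟨τ|`, that is,
`C(π, Θ)_{στ} = e^{i θ_σ} δ_{σ, π(τ)}`. The phases are given as real numbers (angles). -/
def phasedPerm {d : ℕ} (π : Equiv.Perm (CoinIndex d)) (Θ : CoinIndex d → ℝ) :
    Matrix (CoinIndex d) (CoinIndex d) ℂ :=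
  Matrix.of fun σ τ => if σ = π τ then Complex.exp (Complex.I * (Θ σ : ℂ)) else 0

variable {X : Type*} [MeasurableSpace X]

/-- The marginal law `μ(π) = ν(C ∈ {C(π, Θ) : Θ})` on permutations of a random coin matrix `C`. -/
def permLaw {d : ℕ} (ν : Measure X) (C : X → Matrix (CoinIndex d) (CoinIndex d) ℂ)
    (π : Equiv.Perm (CoinIndex d)) : ℝ :=
  ν.real {ω | ∃ Θ : CoinIndex d → ℝ, C ω = phasedPerm π Θ}

/-- The transition matrix `P(σ', σ) = ∑_π μ(π) δ_{σ, π(σ')}`. -/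
def transitionMatrix {d : ℕ} (ν : Measure X) (C : X → Matrix (CoinIndex d) (CoinIndex d) ℂ) :
    Matrix (CoinIndex d) (CoinIndex d) ℝ :=
  Matrix.of fun σ' σ =>
    ∑ π : Equiv.Perm (CoinIndex d), permLaw ν C π * (if σ = π σ' then 1 else 0)

/-- The coin path `τ_j = (π_j π_{j-1} ⋯ π_1)(τ_0)`; the permutation `π_j`, `j ≥ 1`, of the text is
`π (j - 1)` here. -/
def coinPath {d : ℕ} (τ₀ : X → CoinIndex d) (π : ℕ → X → Equiv.Perm (CoinIndex d)) :
    ℕ → X → CoinIndex d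
  | 0 => τ₀
  | j + 1 => fun ω => π j ω (coinPath τ₀ π j ω)

/-- `τ` is a (time-homogeneous) Markov chain on `S` with initial distribution `p₀` and transition
matrix `P`. -/
structure IsMarkovChain {S : Type*} [MeasurableSpace S] (ν : Measure X) (τ : ℕ → X → S)
    (p₀ : S → ℝ) (P : Matrix S S ℝ) : Prop where
  measurable : ∀ n, Measurable (τ n)
  initial : ∀ s, ν.real {ω | τ 0 ω = s} = p₀ s
  transition : ∀ (n : ℕ) (s : ℕ → S) (t : S), ν {ω | ∀ k ≤ n, τ k ω = s k} ≠ 0 →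
    (ν[|{ω | ∀ k ≤ n, τ k ω = s k}]).real {ω | τ (n + 1) ω = t} = P (s n) t

/-- The jump function, with values regarded as vectors of the Euclidean space `ℝ^d`. -/
def jumpVec {d : ℕ} (r : CoinIndex d → Fin d → ℤ) (τ : CoinIndex d) : EuclideanSpace ℝ (Fin d) :=
  WithLp.toLp 2 fun i => (r τ i : ℝ)

/-- The drift `r̄ = (1 / 2d) ∑_τ r(τ)`. -/
def drift {d : ℕ} (r : CoinIndex d → Fin d → ℤ) : EuclideanSpace ℝ (Fin d) :=
  (1 / (2 * d : ℝ)) • ∑ τ, jumpVec r τ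

/-- The projection `Q = 1 - 2d |u₀⟩⟨u₀|`, where `u₀` is the vector with all components `1 / 2d`. -/
def projQ (d : ℕ) : Matrix (CoinIndex d) (CoinIndex d) ℝ :=
  1 - Matrix.of fun _ _ => 1 / (2 * d : ℝ)

/-- The reduced resolvent `S(1)` of `P` at `1`: the inverse of `P_Q - 1`, `P_Q = Q P Q`, on the
range of `Q`, and zero on the range of `1 - Q`. (On the range of `1 - Q` the matrix `Q P Q - 1`
is `-1`, so it is invertible iff its restriction to the range of `Q` is.) -/
def reducedResolvent {d : ℕ} (P : Matrix (CoinIndex d) (CoinIndex d) ℝ) :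
    Matrix (CoinIndex d) (CoinIndex d) ℝ :=
  (projQ d * P * projQ d - 1)⁻¹ * projQ d

/-- The vector `r_i ∈ ℝ^{2d}` of the `i`-th components of the jumps. -/
def jumpComp {d : ℕ} (r : CoinIndex d → Fin d → ℤ) (i : Fin d) : CoinIndex d → ℝ :=
  fun τ => (r τ i : ℝ)

/-- The covariance matrix
`Σ_ij = -(1/2d) ⟨r_i | r_j⟩ + r̄_i r̄_j - (1/2d) (⟨r_i | S(1) r_j⟩ + ⟨r_j | S(1) r_i⟩)`. -/
def covMatrix {d : ℕ} (r : CoinIndex d → Fin d → ℤ)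
    (P : Matrix (CoinIndex d) (CoinIndex d) ℝ) : Matrix (Fin d) (Fin d) ℝ :=
  Matrix.of fun i j =>
    -(1 / (2 * d : ℝ)) * (jumpComp r i ⬝ᵥ jumpComp r j) + drift r i * drift r j
      - (1 / (2 * d : ℝ)) * (jumpComp r i ⬝ᵥ (reducedResolvent P *ᵥ jumpComp r j)
          + jumpComp r j ⬝ᵥ (reducedResolvent P *ᵥ jumpComp r i))

end QuantumWalk

end

/-!
Irreducibility and double stochasticity make `1` a simple eigenvalue of `P` whose left and right
eigenvectors are the constants, so that the Poisson equation `(P - 1) h = f` is solvable for every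
`f` of mean zero, by `h = S(1) f`.

The expectation of `φ(τ_1) ⋯ φ(τ_n)` is governed by the `n`-th power of the tilted matrix
`P(x, t) φ(t)`. For `φ = exp (s f)` with `f` of mean zero, correcting the constant vector by
solutions of Poisson equations turns it into an approximate eigenvector. To first order in a real
`s` this gives an exponential bound on `∑ f(τ_j)`, hence the law of large numbers through the
Borel-Cantelli lemma. To second order, at `s = i / √n`, the approximate eigenvalue is `1 - v / 2n`,
where `v` is the asymptotic variance, so the characteristic function of `∑ f(τ_j) / √n` tends to
`exp (-v / 2)`. This is the one-dimensional central limit theorem, and the vector-valued one follows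
from it by applying it to all linear functionals of the jumps.
-/

namespace QuantumWalk

section Stochastic

variable {S : Type*} [Fintype S] [DecidableEq S] {P : Matrix S S ℝ}

theorem pow_mulVec_eq_self {v : S → ℝ} (hv : P *ᵥ v = v) (k : ℕ) : (P ^ k) *ᵥ v = v := by
  induction k with
  | zero => rw [pow_zero, one_mulVec]
  | succ k ih => rw [pow_succ, ← mulVec_mulVec, hv, ih]

theorem eq_of_mulVec_eq_self (hP : P ∈ rowStochastic ℝ S) (hirr : P.IsIrreducible) {v : S → ℝ}
    (hv : P *ᵥ v = v) (x y : S) : v x = v y := by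
  have : Nonempty S := ⟨x⟩
  obtain ⟨m, hm⟩ := Finite.exists_max v
  suffices h : ∀ z, v z = v m from (h x).trans (h y).symm
  intro z
  obtain ⟨k, -, hk⟩ := (isIrreducible_iff_exists_pow_pos hirr.nonneg).1 hirr m z
  have hPk : P ^ k ∈ rowStochastic ℝ S := pow_mem hP k
  have hsum : ∑ t, (P ^ k) m t * (v m - v t) = 0 := by
    have hvm : ∑ t, (P ^ k) m t * v t = v m := congrFun (pow_mulVec_eq_self hv k) m
    simp only [mul_sub, Finset.sum_sub_distrib, ← Finset.sum_mul, hvm,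
      sum_row_of_mem_rowStochastic hPk, one_mul, sub_self]
  have hterm := (Finset.sum_eq_zero_iff_of_nonneg fun t _ =>
    mul_nonneg (nonneg_of_mem_rowStochastic hPk) (sub_nonneg.2 (hm t))).1 hsum z
    (Finset.mem_univ z)
  exact (sub_eq_zero.1 ((mul_eq_zero.1 hterm).resolve_left hk.ne')).symm

theorem mulVec_sq_le (hP : P ∈ rowStochastic ℝ S) (v : S → ℝ) (x : S) :
    (P *ᵥ v) x ^ 2 ≤ (P *ᵥ (v ^ 2)) x :=
  even_two.convexOn_pow.map_sum_le
    (t := Finset.univ) (w := P x) (p := v) (fun _ _ => nonneg_of_mem_rowStochastic hP)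
    (sum_row_of_mem_rowStochastic hP x) fun _ _ => Set.mem_univ _

theorem dotProduct_mulVec_self_le (hP : P ∈ doublyStochastic ℝ S) (v : S → ℝ) :
    (P *ᵥ v) ⬝ᵥ (P *ᵥ v) ≤ v ⬝ᵥ v :=
  have hrow := (mem_doublyStochastic_iff_mem_rowStochastic_and_mem_colStochastic.1 hP).1
  calc (P *ᵥ v) ⬝ᵥ (P *ᵥ v) = ∑ x, (P *ᵥ v) x ^ 2 := by simp only [dotProduct, sq]
    _ ≤ ∑ x, (P *ᵥ (v ^ 2)) x := Finset.sum_le_sum fun x _ => mulVec_sq_le hrow v x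
    _ = ∑ x, (v ^ 2) x := sum_mulVec_of_mem_doublyStochastic hP
    _ = v ⬝ᵥ v := by simp only [dotProduct, Pi.pow_apply, sq]

end Stochastic

section Resolvent

variable {S R : Type*} [Fintype S] [DecidableEq S] [CommRing R] {P Q : Matrix S S R}

theorem compression_sub_one_mul (hQ : IsIdempotentElem Q) (hQP : Q * (P - 1) = P - 1)
    (hPQ : (P - 1) * Q = P - 1) : (Q * P * Q - 1) * Q = P - 1 :=
  calc (Q * P * Q - 1) * Q = Q * P * (Q * Q) - Q := by noncomm_ring
    _ = Q * (P - 1) * Q := by rw [mul_sub, sub_mul, mul_one, hQ.eq]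
    _ = P - 1 := by rw [hQP, hPQ]

theorem mul_compression_sub_one (hQ : IsIdempotentElem Q) (hQP : Q * (P - 1) = P - 1)
    (hPQ : (P - 1) * Q = P - 1) : Q * (Q * P * Q - 1) = P - 1 :=
  calc Q * (Q * P * Q - 1) = Q * Q * P * Q - Q := by noncomm_ring
    _ = Q * (P - 1) * Q := by rw [mul_sub, sub_mul, mul_one, hQ.eq]
    _ = P - 1 := by rw [hQP, hPQ]

theorem sub_one_mul_inv_mul (hQ : IsIdempotentElem Q) (hQP : Q * (P - 1) = P - 1)
    (hPQ : (P - 1) * Q = P - 1) (hu : IsUnit (Q * P * Q - 1)) :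
    (P - 1) * ((Q * P * Q - 1)⁻¹ * Q) = Q := by
  rw [← mul_compression_sub_one hQ hQP hPQ, ← Matrix.mul_assoc,
    mul_nonsing_inv_cancel_right _ _ ((isUnit_iff_isUnit_det _).1 hu), hQ]

theorem inv_mul_mul_sub_one (hQ : IsIdempotentElem Q) (hQP : Q * (P - 1) = P - 1)
    (hPQ : (P - 1) * Q = P - 1) (hu : IsUnit (Q * P * Q - 1)) :
    (Q * P * Q - 1)⁻¹ * Q * (P - 1) = Q := by
  rw [Matrix.mul_assoc, hQP, ← compression_sub_one_mul hQ hQP hPQ,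
    nonsing_inv_mul_cancel_left _ _ ((isUnit_iff_isUnit_det _).1 hu)]

theorem mul_inv_mul (hQ : IsIdempotentElem Q) (hQP : Q * (P - 1) = P - 1)
    (hPQ : (P - 1) * Q = P - 1) (hu : IsUnit (Q * P * Q - 1)) :
    Q * ((Q * P * Q - 1)⁻¹ * Q) = (Q * P * Q - 1)⁻¹ * Q :=
  calc Q * ((Q * P * Q - 1)⁻¹ * Q)
      = (Q * P * Q - 1)⁻¹ * Q * (P - 1) * ((Q * P * Q - 1)⁻¹ * Q) := by
        rw [inv_mul_mul_sub_one hQ hQP hPQ hu]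
    _ = (Q * P * Q - 1)⁻¹ * (Q * Q) := by
        rw [Matrix.mul_assoc _ (P - 1), sub_one_mul_inv_mul hQ hQP hPQ hu, Matrix.mul_assoc]
    _ = (Q * P * Q - 1)⁻¹ * Q := by rw [hQ]

theorem isUnit_compression_sub_one {K : Type*} [Field K] {P Q : Matrix S S K}
    (hQ : IsIdempotentElem Q) (hQP : Q * (P - 1) = P - 1) (hPQ : (P - 1) * Q = P - 1)
    (hker : ∀ v, P *ᵥ v = v → Q *ᵥ v = 0) : IsUnit (Q * P * Q - 1) := by
  rw [← mulVec_injective_iff_isUnit]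
  refine (injective_iff_map_eq_zero (mulVecLin (Q * P * Q - 1))).2 fun v hv => ?_
  rw [mulVecLin_apply] at hv
  have hharm : (P - 1) *ᵥ v = 0 := by
    rw [← mul_compression_sub_one hQ hQP hPQ, ← mulVec_mulVec, hv, mulVec_zero]
  rw [sub_mulVec, one_mulVec, sub_eq_zero] at hharm hv
  rw [← hv, ← mulVec_mulVec, hker v hharm, mulVec_zero]

end Resolvent

section MeanZero

variable {S : Type*} [Fintype S] [DecidableEq S]

/-- The orthogonal projection of `ℝ^S` onto the vectors of mean zero. -/
noncomputable def meanZeroProj (S : Type*) [Fintype S] [DecidableEq S] : Matrix S S ℝ :=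
  1 - Matrix.of fun _ _ => (Fintype.card S : ℝ)⁻¹

theorem meanZeroProj_mulVec_apply (v : S → ℝ) (x : S) :
    (meanZeroProj S *ᵥ v) x = v x - (Fintype.card S : ℝ)⁻¹ * ∑ y, v y := by
  rw [meanZeroProj, sub_mulVec, one_mulVec, Pi.sub_apply]
  simp only [mulVec, dotProduct, of_apply, Finset.mul_sum]

theorem transpose_meanZeroProj : (meanZeroProj S)ᵀ = meanZeroProj S := by
  rw [meanZeroProj, transpose_sub, transpose_one]
  rfl

theorem meanZeroProj_mulVec_dotProduct (v w : S → ℝ) :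
    (meanZeroProj S *ᵥ v) ⬝ᵥ w = v ⬝ᵥ (meanZeroProj S *ᵥ w) := by
  rw [dotProduct_mulVec, ← mulVec_transpose, transpose_meanZeroProj]

theorem sum_meanZeroProj_mulVec (v : S → ℝ) : ∑ x, (meanZeroProj S *ᵥ v) x = 0 := by
  cases isEmpty_or_nonempty S
  · exact Fintype.sum_empty _
  · simp only [meanZeroProj_mulVec_apply, Finset.sum_sub_distrib, Finset.sum_const,
      Finset.card_univ, nsmul_eq_mul]
    rw [mul_inv_cancel_left₀ (Nat.cast_ne_zero.2 Fintype.card_ne_zero), sub_self]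

theorem meanZeroProj_mulVec_of_sum_eq_zero {v : S → ℝ} (hv : ∑ x, v x = 0) :
    meanZeroProj S *ᵥ v = v := by
  ext x
  rw [meanZeroProj_mulVec_apply, hv, mul_zero, sub_zero]

theorem meanZeroProj_mulVec_eq_zero {v : S → ℝ} (hv : ∀ x y, v x = v y) :
    meanZeroProj S *ᵥ v = 0 := by
  ext x
  have : Nonempty S := ⟨x⟩
  rw [meanZeroProj_mulVec_apply, Finset.sum_congr rfl fun y _ => hv y x, Finset.sum_const,
    Finset.card_univ, nsmul_eq_mul, inv_mul_cancel_left₀ (Nat.cast_ne_zero.2 Fintype.card_ne_zero),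
    sub_self, Pi.zero_apply]

theorem isIdempotentElem_meanZeroProj : IsIdempotentElem (meanZeroProj S) :=
  ext_iff_mulVec.2 fun v => by
    rw [← mulVec_mulVec, meanZeroProj_mulVec_of_sum_eq_zero (sum_meanZeroProj_mulVec v)]

variable {P : Matrix S S ℝ}

theorem meanZeroProj_mul_sub_one (hP : P ∈ doublyStochastic ℝ S) :
    meanZeroProj S * (P - 1) = P - 1 :=
  ext_iff_mulVec.2 fun v => by
    rw [← mulVec_mulVec, meanZeroProj_mulVec_of_sum_eq_zero]
    simp only [sub_mulVec, one_mulVec, Pi.sub_apply, Finset.sum_sub_distrib,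
      sum_mulVec_of_mem_doublyStochastic hP, sub_self]

theorem sub_one_mul_meanZeroProj (hP : P ∈ doublyStochastic ℝ S) :
    (P - 1) * meanZeroProj S = P - 1 := by
  have h := congrArg transpose (meanZeroProj_mul_sub_one (transpose_mem_doublyStochastic_iff.2 hP))
  simpa only [transpose_mul, transpose_sub, transpose_one, transpose_transpose,
    transpose_meanZeroProj] using h

theorem isUnit_meanZeroProj_compression_sub_one (hP : P ∈ doublyStochastic ℝ S)
    (hirr : P.IsIrreducible) : IsUnit (meanZeroProj S * P * meanZeroProj S - 1) :=
  isUnit_compression_sub_one isIdempotentElem_meanZeroProj (meanZeroProj_mul_sub_one hP)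
    (sub_one_mul_meanZeroProj hP) fun _ hv =>
      meanZeroProj_mulVec_eq_zero (eq_of_mulVec_eq_self
        (mem_doublyStochastic_iff_mem_rowStochastic_and_mem_colStochastic.1 hP).1 hirr hv)

theorem exists_sub_one_mulVec_eq (hP : P ∈ doublyStochastic ℝ S) (hirr : P.IsIrreducible)
    {f : S → ℝ} (hf : ∑ x, f x = 0) : ∃ h, (P - 1) *ᵥ h = f := by
  refine ⟨((meanZeroProj S * P * meanZeroProj S - 1)⁻¹ * meanZeroProj S) *ᵥ f, ?_⟩
  rw [mulVec_mulVec, sub_one_mul_inv_mul isIdempotentElem_meanZeroProj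
    (meanZeroProj_mul_sub_one hP) (sub_one_mul_meanZeroProj hP)
    (isUnit_meanZeroProj_compression_sub_one hP hirr), meanZeroProj_mulVec_of_sum_eq_zero hf]

end MeanZero

section AsymptoticVariance

variable {S : Type*} [Fintype S] [DecidableEq S] {P : Matrix S S ℝ}

/-- The asymptotic variance, under the uniform stationary law, of the additive functional of
`f = (P - 1) h`, expressed through the solution `h` of this Poisson equation: it is the variance
of the martingale increment `h(τ_{j+1}) - (P h)(τ_j)`. -/
noncomputable def asymptoticVariance (P : Matrix S S ℝ) (h : S → ℝ) : ℝ :=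
  (Fintype.card S : ℝ)⁻¹ * (h ⬝ᵥ h - (P *ᵥ h) ⬝ᵥ (P *ᵥ h))

theorem asymptoticVariance_nonneg (hP : P ∈ doublyStochastic ℝ S) (h : S → ℝ) :
    0 ≤ asymptoticVariance P h :=
  mul_nonneg (inv_nonneg.2 (Nat.cast_nonneg _)) (sub_nonneg.2 (dotProduct_mulVec_self_le hP h))

theorem asymptoticVariance_of_sub_one_mulVec_eq {h f : S → ℝ} (hf : (P - 1) *ᵥ h = f) :
    asymptoticVariance P h = -(Fintype.card S : ℝ)⁻¹ * (f ⬝ᵥ f + 2 * (f ⬝ᵥ h)) := by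
  have hPh : P *ᵥ h = h + f := by rw [← hf, sub_mulVec, one_mulVec, add_sub_cancel]
  rw [asymptoticVariance, hPh]
  simp only [add_dotProduct, dotProduct_add, dotProduct_comm h f]
  ring

theorem exists_second_corrector (hP : P ∈ doublyStochastic ℝ S) (hirr : P.IsIrreducible)
    (h : S → ℝ) :
    ∃ k, ∀ x, ((P - 1) *ᵥ k) x = (h x ^ 2 - (P *ᵥ h) x ^ 2 - asymptoticVariance P h) / 2 := by
  suffices hsum : ∑ x, (h x ^ 2 - (P *ᵥ h) x ^ 2 - asymptoticVariance P h) / 2 = 0 by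
    obtain ⟨k, hk⟩ := exists_sub_one_mulVec_eq hP hirr hsum
    exact ⟨k, congrFun hk⟩
  cases isEmpty_or_nonempty S
  · exact Fintype.sum_empty _
  rw [← Finset.sum_div, Finset.sum_sub_distrib, Finset.sum_sub_distrib, Finset.sum_const,
    Finset.card_univ, nsmul_eq_mul, asymptoticVariance,
    mul_inv_cancel_left₀ (Nat.cast_ne_zero.2 Fintype.card_ne_zero)]
  simp only [dotProduct, sq, sub_self, zero_div]

end AsymptoticVariance

section FiniteValued

variable {T E X : Type*} [MeasurableSpace T] [MeasurableSingletonClass T] [MeasurableSpace X]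
  [NormedAddCommGroup E] {ν : Measure X} [IsFiniteMeasure ν] {Y : X → T}

theorem integrable_comp_of_finite [Finite T] (hY : Measurable Y) (g : T → E) :
    Integrable (fun ω => g (Y ω)) ν :=
  (Integrable.of_finite (μ := ν.map Y) (f := g)).comp_measurable hY

theorem integral_comp_eq_sum [Fintype T] [NormedSpace ℝ E] [CompleteSpace E] (hY : Measurable Y)
    (g : T → E) : ∫ ω, g (Y ω) ∂ν = ∑ y, ν.real {ω | Y ω = y} • g y := by
  rw [← integral_map hY.aemeasurable AEStronglyMeasurable.of_discrete,
    integral_fintype Integrable.of_finite]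
  refine Finset.sum_congr rfl fun y _ => ?_
  rw [map_measureReal_apply hY (measurableSet_singleton y)]
  rfl

end FiniteValued

section Tilt

variable {S 𝕜 : Type*} [RCLike 𝕜]

/-- The transition matrix `P` tilted by the weight `φ` of the target state. Its powers govern the
expectations of the multiplicative functionals `φ(τ_1) ⋯ φ(τ_n)` of the chain. -/
def tiltedMatrix (P : Matrix S S ℝ) (φ : S → 𝕜) : Matrix S S 𝕜 :=
  Matrix.of fun x t => (P x t : 𝕜) * φ t

theorem tiltedMatrix_mulVec_apply [Fintype S] (P : Matrix S S ℝ) (φ u : S → 𝕜) (x : S) :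
    (tiltedMatrix P φ *ᵥ u) x = ∑ t, (P x t : 𝕜) * (φ t * u t) :=
  Finset.sum_congr rfl fun _ _ => mul_assoc _ _ _

theorem tiltedMatrix_mulVec_mul_apply [Fintype S] (P : Matrix S S ℝ) {φ ψ : S → 𝕜}
    (hφψ : φ * ψ = 1) (v : S → 𝕜) (x : S) :
    (tiltedMatrix P φ *ᵥ (ψ * v)) x = ∑ t, (P x t : 𝕜) * v t := by
  rw [tiltedMatrix_mulVec_apply]
  refine Finset.sum_congr rfl fun t _ => ?_
  rw [Pi.mul_apply, ← mul_assoc (φ t), ← Pi.mul_apply φ, hφψ, Pi.one_apply, one_mul]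

end Tilt

theorem dependsOn_prod_mul {S M : Type*} [CommMonoid M] (φ u : S → M) (n : ℕ) :
    DependsOn (fun s : ℕ → S => (∏ j ∈ Finset.Icc 1 n, φ (s j)) * u (s n)) (Set.Iic n) :=
  fun _ _ hst => congrArg₂ (· * ·)
    (Finset.prod_congr rfl fun j hj => congrArg φ (hst j (Finset.mem_Icc.1 hj).2))
    (congrArg u (hst n Set.self_mem_Iic))

theorem measurableSet_path {S X : Type*} [MeasurableSpace S] [MeasurableSingletonClass S]
    [MeasurableSpace X] {τ : ℕ → X → S} (hτ : ∀ n, Measurable (τ n)) (n : ℕ) (s : ℕ → S) :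
    MeasurableSet {ω | ∀ k ≤ n, τ k ω = s k} := by
  simp only [Set.ofPred_forall]
  exact .iInter fun k => .iInter fun _ => hτ k (measurableSet_singleton (s k))

namespace IsMarkovChain

variable {S X : Type*} [MeasurableSpace S] [MeasurableSingletonClass S] [MeasurableSpace X]
  {ν : Measure X} [IsFiniteMeasure ν] {τ : ℕ → X → S} {p₀ : S → ℝ} {P : Matrix S S ℝ}

theorem measureReal_path_inter_succ (hτ : IsMarkovChain ν τ p₀ P) (n : ℕ) (s : ℕ → S) (t : S) :
    ν.real ({ω | ∀ k ≤ n, τ k ω = s k} ∩ {ω | τ (n + 1) ω = t})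
      = ν.real {ω | ∀ k ≤ n, τ k ω = s k} * P (s n) t := by
  have hmeas := measurableSet_path hτ.measurable n s
  by_cases h0 : ν {ω | ∀ k ≤ n, τ k ω = s k} = 0
  · rw [measureReal_def, measureReal_def, h0, measure_mono_null Set.inter_subset_left h0,
      ENNReal.toReal_zero, zero_mul]
  · rw [← hτ.transition n s t h0, mul_comm, measureReal_def, measureReal_def, measureReal_def,
      ← ENNReal.toReal_mul, cond_mul_eq_inter hmeas]

variable {𝕜 : Type*} [RCLike 𝕜]

section Integrability

variable [Finite S]

theorem integrable_of_dependsOn (hτ : IsMarkovChain ν τ p₀ P) {E : Type*} [NormedAddCommGroup E]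
    {n : ℕ} {F : (ℕ → S) → E} (hF : DependsOn F (Set.Iic n)) :
    Integrable (fun ω => F fun k => τ k ω) ν := by
  obtain ⟨g, rfl⟩ := dependsOn_iff_exists_comp.1 hF
  exact integrable_comp_of_finite (Y := fun ω (k : Set.Iic n) => τ k ω)
    (measurable_pi_lambda _ fun k => hτ.measurable k) g

theorem integrable_prod_mul (hτ : IsMarkovChain ν τ p₀ P) (φ u : S → 𝕜) (n : ℕ) :
    Integrable (fun ω => (∏ j ∈ Finset.Icc 1 n, φ (τ j ω)) * u (τ n ω)) ν :=
  hτ.integrable_of_dependsOn (dependsOn_prod_mul φ u n)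

theorem integrable_prod (hτ : IsMarkovChain ν τ p₀ P) (φ : S → 𝕜) (n : ℕ) :
    Integrable (fun ω => ∏ j ∈ Finset.Icc 1 n, φ (τ j ω)) ν := by
  simpa only [mul_one] using hτ.integrable_prod_mul φ (fun _ => 1) n

end Integrability

variable [Fintype S]

theorem integral_mul_comp_succ (hτ : IsMarkovChain ν τ p₀ P) {n : ℕ} {F : (ℕ → S) → 𝕜}
    (hF : DependsOn F (Set.Iic n)) (u : S → 𝕜) :
    ∫ ω, F (fun k => τ k ω) * u (τ (n + 1) ω) ∂ν
      = ∫ ω, F (fun k => τ k ω) * ∑ t, (P (τ n ω) t : 𝕜) * u t ∂ν := by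
  obtain ⟨g, rfl⟩ := dependsOn_iff_exists_comp.1 hF
  let Y : X → Set.Iic n → S := fun ω k => τ k ω
  have hY : Measurable Y := measurable_pi_lambda _ fun k => hτ.measurable k
  have hpast : ∫ ω, g (Y ω) * u (τ (n + 1) ω) ∂ν
      = ∑ y, ∑ t, ν.real {ω | (Y ω, τ (n + 1) ω) = (y, t)} • (g y * u t) := by
    rw [← Fintype.sum_prod_type']
    exact integral_comp_eq_sum (hY.prodMk (hτ.measurable (n + 1)))
      fun p : (Set.Iic n → S) × S => g p.1 * u p.2
  have hjoint (y : Set.Iic n → S) (t : S) : ν.real {ω | (Y ω, τ (n + 1) ω) = (y, t)}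
      = ν.real {ω | Y ω = y} * P (y ⟨n, Set.self_mem_Iic⟩) t := by
    simp only [Prod.mk.injEq, Set.ofPred_and]
    obtain hempty | ⟨ω₀, rfl⟩ := Set.eq_empty_or_nonempty {ω | Y ω = y}
    · simp only [hempty, Set.empty_inter, measureReal_empty, zero_mul]
    · have hset : {ω | Y ω = Y ω₀} = {ω | ∀ k ≤ n, τ k ω = τ k ω₀} :=
        Set.ext fun ω => funext_iff.trans Subtype.forall
      rw [hset]
      exact hτ.measureReal_path_inter_succ n (fun k => τ k ω₀) t
  calc ∫ ω, g (Y ω) * u (τ (n + 1) ω) ∂ν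
      = ∑ y, ν.real {ω | Y ω = y} •
          (g y * ∑ t, (P (y ⟨n, Set.self_mem_Iic⟩) t : 𝕜) * u t) := by
        simp only [hpast, hjoint, Finset.mul_sum, Finset.smul_sum, RCLike.real_smul_eq_coe_mul,
          RCLike.ofReal_mul]
        refine Finset.sum_congr rfl fun y _ => Finset.sum_congr rfl fun t _ => ?_
        ring
    _ = ∫ ω, g (Y ω) * ∑ t, (P (τ n ω) t : 𝕜) * u t ∂ν :=
        (integral_comp_eq_sum hY _).symm

theorem integral_prod_mul_succ (hτ : IsMarkovChain ν τ p₀ P) (φ u : S → 𝕜) (n : ℕ) :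
    ∫ ω, (∏ j ∈ Finset.Icc 1 (n + 1), φ (τ j ω)) * u (τ (n + 1) ω) ∂ν
      = ∫ ω, (∏ j ∈ Finset.Icc 1 n, φ (τ j ω)) * (tiltedMatrix P φ *ᵥ u) (τ n ω) ∂ν := by
  have hF : DependsOn (fun s : ℕ → S => ∏ j ∈ Finset.Icc 1 n, φ (s j)) (Set.Iic n) := by
    simpa only [mul_one] using dependsOn_prod_mul φ (fun _ => 1) n
  simp only [Finset.prod_Icc_succ_top (Nat.le_add_left 1 n), mul_assoc, tiltedMatrix_mulVec_apply]
  exact hτ.integral_mul_comp_succ hF fun t => φ t * u t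

theorem exists_integral_prod_le (hτ : IsMarkovChain ν τ p₀ P) {φ u : S → ℝ} {b : ℝ}
    (hφ : ∀ x, 0 ≤ φ x) (hu : ∀ x, 0 < u x) (hb : 0 ≤ b) (hle : tiltedMatrix P φ *ᵥ u ≤ b • u) :
    ∃ C, ∀ n, ∫ ω, ∏ j ∈ Finset.Icc 1 n, φ (τ j ω) ∂ν ≤ C * b ^ n := by
  have hprod (n : ℕ) (ω : X) : 0 ≤ ∏ j ∈ Finset.Icc 1 n, φ (τ j ω) :=
    Finset.prod_nonneg fun j _ => hφ (τ j ω)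
  have hstep (n : ℕ) : ∫ ω, (∏ j ∈ Finset.Icc 1 n, φ (τ j ω)) * u (τ n ω) ∂ν
      ≤ (∫ ω, u (τ 0 ω) ∂ν) * b ^ n := by
    induction n with
    | zero => simp
    | succ n ih =>
      calc ∫ ω, (∏ j ∈ Finset.Icc 1 (n + 1), φ (τ j ω)) * u (τ (n + 1) ω) ∂ν
          = ∫ ω, (∏ j ∈ Finset.Icc 1 n, φ (τ j ω)) * (tiltedMatrix P φ *ᵥ u) (τ n ω) ∂ν :=
            hτ.integral_prod_mul_succ φ u n
        _ ≤ ∫ ω, (∏ j ∈ Finset.Icc 1 n, φ (τ j ω)) * (b • u) (τ n ω) ∂ν :=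
            integral_mono (hτ.integrable_prod_mul φ _ n) (hτ.integrable_prod_mul φ _ n)
              fun ω => mul_le_mul_of_nonneg_left (hle (τ n ω)) (hprod n ω)
        _ = b * ∫ ω, (∏ j ∈ Finset.Icc 1 n, φ (τ j ω)) * u (τ n ω) ∂ν := by
            simp only [Pi.smul_apply, smul_eq_mul, mul_left_comm _ b, integral_const_mul]
        _ ≤ b * ((∫ ω, u (τ 0 ω) ∂ν) * b ^ n) := by gcongr
        _ = (∫ ω, u (τ 0 ω) ∂ν) * b ^ (n + 1) := by ring
  obtain ⟨c, hc, hcu⟩ : ∃ c > 0, ∀ x, c ≤ u x := by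
    cases isEmpty_or_nonempty S
    · exact ⟨1, one_pos, isEmptyElim⟩
    · obtain ⟨m, hm⟩ := Finite.exists_min u
      exact ⟨u m, hu m, hm⟩
  refine ⟨(∫ ω, u (τ 0 ω) ∂ν) / c, fun n => ?_⟩
  rw [div_mul_eq_mul_div, le_div_iff₀ hc, ← integral_mul_const]
  refine (integral_mono ((hτ.integrable_prod φ n).mul_const c) (hτ.integrable_prod_mul φ u n)
    fun ω => ?_).trans (hstep n)
  exact mul_le_mul_of_nonneg_left (hcu _) (hprod n ω)

end IsMarkovChain

section LawOfLargeNumbers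

variable {S : Type*} [Fintype S] [DecidableEq S] {P : Matrix S S ℝ}

theorem exists_tiltedMatrix_exp_mulVec_le (hrow : P *ᵥ 1 = 1) {h f : S → ℝ}
    (hf : (P - 1) *ᵥ h = f) {ε : ℝ} (hε : 0 < ε) :
    ∃ a > 0, ∃ u : S → ℝ, (∀ x, 0 < u x) ∧
      tiltedMatrix P (fun x => Real.exp (a * f x)) *ᵥ u ≤ Real.exp (a * ε) • u := by
  have hsmall : ∀ᶠ a in 𝓝[>] (0 : ℝ), ∀ x, 0 < 1 - a * h x ∧ a * ((ε - f x) * h x) < ε := by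
    refine eventually_all.2 fun x => nhdsWithin_le_nhds (Eventually.and ?_ ?_)
    · exact (Continuous.tendsto' (by fun_prop) 0 1 (by ring)).eventually (lt_mem_nhds one_pos)
    · exact (Continuous.tendsto' (by fun_prop) 0 0 (by ring)).eventually (gt_mem_nhds hε)
  obtain ⟨a, ha, ha0⟩ := (hsmall.and self_mem_nhdsWithin).exists
  replace ha0 : 0 < a := ha0
  have hPv : P *ᵥ (1 - a • h) = 1 - a • (h + f) := by
    rw [mulVec_sub, hrow, mulVec_smul, ← hf, sub_mulVec, one_mulVec, add_sub_cancel]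
  have hinv : (fun x => Real.exp (a * f x)) * (fun x => Real.exp (-(a * f x))) = 1 :=
    funext fun x => by rw [Pi.mul_apply, ← Real.exp_add, add_neg_cancel, Real.exp_zero]; rfl
  refine ⟨a, ha0, (fun x => Real.exp (-(a * f x))) * (1 - a • h),
    fun x => mul_pos (Real.exp_pos _) (ha x).1, fun x => ?_⟩
  calc (tiltedMatrix P (fun x => Real.exp (a * f x)) *ᵥ _) x
      = 1 - a * (h x + f x) := (tiltedMatrix_mulVec_mul_apply P hinv _ x).trans (congrFun hPv x)
    _ ≤ (a * (ε - f x) + 1) * (1 - a * h x) := by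
        nlinarith [mul_pos ha0 (sub_pos.2 (ha x).2)]
    _ ≤ Real.exp (a * (ε - f x)) * (1 - a * h x) := by
        gcongr
        exacts [(ha x).1.le, Real.add_one_le_exp _]
    _ = Real.exp (a * ε) * (Real.exp (-(a * f x)) * (1 - a * h x)) := by
        rw [← mul_assoc, ← Real.exp_add, ← sub_eq_add_neg, ← mul_sub]

namespace IsMarkovChain

variable {X : Type*} [MeasurableSpace X] [MeasurableSpace S] [MeasurableSingletonClass S]
  {ν : Measure X} [IsFiniteMeasure ν] {τ : ℕ → X → S} {p₀ : S → ℝ}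

theorem ae_eventually_sum_lt (hτ : IsMarkovChain ν τ p₀ P) (hrow : P *ᵥ 1 = 1) {h f : S → ℝ}
    (hf : (P - 1) *ᵥ h = f) {ε : ℝ} (hε : 0 < ε) :
    ∀ᵐ ω ∂ν, ∀ᶠ n : ℕ in atTop, ∑ j ∈ Finset.Icc 1 n, f (τ j ω) < n * ε := by
  obtain ⟨a, ha, u, hu, hle⟩ := exists_tiltedMatrix_exp_mulVec_le hrow hf (half_pos hε)
  obtain ⟨C, hC⟩ := hτ.exists_integral_prod_le (fun _ => (Real.exp_pos _).le) hu
    (Real.exp_pos _).le hle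
  have hexp (n : ℕ) (ω : X) : Real.exp (a * ∑ j ∈ Finset.Icc 1 n, f (τ j ω))
      = ∏ j ∈ Finset.Icc 1 n, Real.exp (a * f (τ j ω)) := by
    rw [Finset.mul_sum, Real.exp_sum]
  have hchernoff (n : ℕ) : ν.real {ω | n * ε ≤ ∑ j ∈ Finset.Icc 1 n, f (τ j ω)}
      ≤ C * Real.exp (-(a * (ε / 2))) ^ n := by
    refine (measure_ge_le_exp_mul_mgf _ ha.le ?_).trans ?_
    · simpa only [hexp] using hτ.integrable_prod (fun x => Real.exp (a * f x)) n
    · rw [mgf]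
      simp only [hexp]
      refine (mul_le_mul_of_nonneg_left (hC n) (Real.exp_pos _).le).trans_eq ?_
      rw [mul_left_comm, ← Real.exp_nat_mul, ← Real.exp_nat_mul, ← Real.exp_add]
      ring_nf
  have hsummable : Summable fun n : ℕ =>
      ν.real {ω | n * ε ≤ ∑ j ∈ Finset.Icc 1 n, f (τ j ω)} :=
    .of_nonneg_of_le (fun _ => measureReal_nonneg) hchernoff
      ((summable_geometric_of_lt_one (Real.exp_pos _).le
        (Real.exp_lt_one_iff.2 (neg_neg_of_pos (mul_pos ha (half_pos hε))))).mul_left C)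
  have htsum := hsummable.tsum_ofReal_ne_top
  simp only [ofReal_measureReal (measure_ne_top ν _)] at htsum
  filter_upwards [ae_eventually_notMem htsum] with ω hω
  simpa only [Set.mem_ofPred_eq, not_le] using hω

theorem ae_tendsto_sum_div_zero (hτ : IsMarkovChain ν τ p₀ P) (hrow : P *ᵥ 1 = 1) {h f : S → ℝ}
    (hf : (P - 1) *ᵥ h = f) :
    ∀ᵐ ω ∂ν, Tendsto (fun n : ℕ => (∑ j ∈ Finset.Icc 1 n, f (τ j ω)) / n) atTop (𝓝 0) := by
  have hneg : (P - 1) *ᵥ (-h) = -f := by rw [mulVec_neg, hf]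
  have hm (m : ℕ) : (0 : ℝ) < 1 / (m + 1) := Nat.one_div_pos_of_nat
  filter_upwards [ae_all_iff.2 fun m => hτ.ae_eventually_sum_lt hrow hf (hm m),
    ae_all_iff.2 fun m => hτ.ae_eventually_sum_lt hrow hneg (hm m)] with ω hupper hlower
  refine Metric.tendsto_nhds.2 fun δ hδ => ?_
  obtain ⟨m, hmδ⟩ := exists_nat_one_div_lt hδ
  filter_upwards [hupper m, hlower m, eventually_gt_atTop 0] with n hn hn' hpos
  have hpos' : (0 : ℝ) < n := Nat.cast_pos.2 hpos
  simp only [Pi.neg_apply, Finset.sum_neg_distrib] at hn'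
  rw [dist_zero_right, Real.norm_eq_abs, abs_div, Nat.abs_cast, div_lt_iff₀' hpos']
  exact (abs_lt.2 ⟨neg_lt.1 hn', hn⟩).trans (mul_lt_mul_of_pos_left hmδ hpos')

theorem ae_tendsto_frequency (hτ : IsMarkovChain ν τ p₀ P) (hP : P ∈ doublyStochastic ℝ S)
    (hirr : P.IsIrreducible) (x : S) :
    ∀ᵐ ω ∂ν, Tendsto (fun n : ℕ => (∑ j ∈ Finset.Icc 1 n, (Pi.single x 1 : S → ℝ) (τ j ω)) / n)
      atTop (𝓝 (Fintype.card S : ℝ)⁻¹) := by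
  obtain ⟨h, hf⟩ := exists_sub_one_mulVec_eq hP hirr (sum_meanZeroProj_mulVec (Pi.single x 1))
  filter_upwards [hτ.ae_tendsto_sum_div_zero (mem_doublyStochastic.1 hP).2.1 hf] with ω hω
  have hlim := hω.add_const (Fintype.card S : ℝ)⁻¹
  rw [zero_add] at hlim
  refine hlim.congr' ?_
  filter_upwards [eventually_ne_atTop 0] with n hn
  simp only [meanZeroProj_mulVec_apply, Finset.sum_pi_single', Finset.mem_univ, if_true, mul_one,
    Finset.sum_sub_distrib, Finset.sum_const, Nat.card_Icc, Nat.add_sub_cancel, nsmul_eq_mul]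
  rw [sub_div, mul_div_cancel_left₀ _ (Nat.cast_ne_zero.2 hn), sub_add_cancel]

theorem ae_tendsto_average {E : Type*} [AddCommGroup E] [Module ℝ E] [TopologicalSpace E]
    [ContinuousAdd E] [ContinuousSMul ℝ E] (hτ : IsMarkovChain ν τ p₀ P)
    (hP : P ∈ doublyStochastic ℝ S) (hirr : P.IsIrreducible) (F : S → E) :
    ∀ᵐ ω ∂ν, Tendsto (fun n : ℕ => (1 / (n : ℝ)) • ∑ j ∈ Finset.Icc 1 n, F (τ j ω)) atTop
      (𝓝 ((Fintype.card S : ℝ)⁻¹ • ∑ x, F x)) := by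
  filter_upwards [ae_all_iff.2 (hτ.ae_tendsto_frequency hP hirr)] with ω hω
  rw [Finset.smul_sum]
  refine (tendsto_finsetSum _ fun x _ => (hω x).smul_const (F x)).congr fun n => ?_
  have hF (j : ℕ) : F (τ j ω) = ∑ x, (Pi.single x 1 : S → ℝ) (τ j ω) • F x := by
    simp only [Pi.single_apply, ite_smul, one_smul, zero_smul, Finset.sum_ite_eq, Finset.mem_univ,
      if_true]
  simp only [hF, div_eq_inv_mul, mul_one, mul_smul, Finset.sum_smul, ← Finset.smul_sum]
  rw [Finset.sum_comm]

end IsMarkovChain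

end LawOfLargeNumbers

section CharacteristicFunction

variable {S X : Type*} [Fintype S] [MeasurableSpace S] [MeasurableSingletonClass S]
  [MeasurableSpace X] {ν : Measure X} [IsProbabilityMeasure ν] {τ : ℕ → X → S} {p₀ : S → ℝ}
  {P : Matrix S S ℝ}

theorem IsMarkovChain.norm_integral_prod_sub_pow_le {𝕜 : Type*} [RCLike 𝕜]
    (hτ : IsMarkovChain ν τ p₀ P) {φ : S → 𝕜} (hφ : ∀ x, ‖φ x‖ ≤ 1) {c : 𝕜} (hc : ‖c‖ ≤ 1)
    (u : S → 𝕜) (n : ℕ) :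
    ‖∫ ω, ∏ j ∈ Finset.Icc 1 n, φ (τ j ω) ∂ν - c ^ n‖
      ≤ n * ‖tiltedMatrix P φ *ᵥ u - c • u‖ + 2 * ‖u - 1‖ := by
  let J (n : ℕ) (w : S → 𝕜) : 𝕜 := ∫ ω, (∏ j ∈ Finset.Icc 1 n, φ (τ j ω)) * w (τ n ω) ∂ν
  have hJ (n : ℕ) (w : S → 𝕜) : ‖J n w‖ ≤ ‖w‖ := by
    have hprod (ω : X) : ‖∏ j ∈ Finset.Icc 1 n, φ (τ j ω)‖ ≤ 1 :=
      (norm_prod _ _).trans_le (Finset.prod_le_one (fun _ _ => norm_nonneg _) fun j _ => hφ _)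
    simpa only [probReal_univ, mul_one] using
      norm_integral_le_of_norm_le_const (μ := ν) (C := ‖w‖) (ae_of_all _ fun ω =>
        (norm_mul_le_of_le (hprod ω) (norm_le_pi_norm w (τ n ω))).trans_eq (one_mul _))
  have hJsub (n : ℕ) (w w' : S → 𝕜) : J n (w - w') = J n w - J n w' := by
    simp only [J, Pi.sub_apply, mul_sub]
    exact integral_sub (hτ.integrable_prod_mul φ w n) (hτ.integrable_prod_mul φ w' n)
  have hJsmul (n : ℕ) (w : S → 𝕜) : J n (c • w) = c * J n w := by
    simp only [J, Pi.smul_apply, smul_eq_mul, mul_left_comm _ c, integral_const_mul]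
  have hJsucc (n : ℕ) : J (n + 1) u = J n (tiltedMatrix P φ *ᵥ u) :=
    hτ.integral_prod_mul_succ φ u n
  have hJone (n : ℕ) : J n 1 = ∫ ω, ∏ j ∈ Finset.Icc 1 n, φ (τ j ω) ∂ν := by
    simp only [J, Pi.one_apply, mul_one]
  have hJu : ‖J n u - c ^ n‖ ≤ n * ‖tiltedMatrix P φ *ᵥ u - c • u‖ + ‖u - 1‖ := by
    induction n with
    | zero =>
      have hzero : J 0 u - c ^ 0 = J 0 (u - 1) := by simp [hJsub, hJone]
      rw [hzero, Nat.cast_zero, zero_mul, zero_add]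
      exact hJ 0 (u - 1)
    | succ n ih =>
      have hdecomp : J (n + 1) u - c ^ (n + 1)
          = J n (tiltedMatrix P φ *ᵥ u - c • u) + c * (J n u - c ^ n) := by
        rw [hJsub, hJsmul, hJsucc]
        ring
      rw [hdecomp, Nat.cast_succ]
      refine (norm_add_le_of_le (hJ n _) (norm_mul_le_of_le hc ih)).trans_eq ?_
      ring
  calc ‖∫ ω, ∏ j ∈ Finset.Icc 1 n, φ (τ j ω) ∂ν - c ^ n‖
      = ‖(J n u - c ^ n) - J n (u - 1)‖ := by
        rw [hJsub, hJone, sub_sub_sub_comm, sub_self, zero_sub, neg_sub]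
    _ ≤ n * ‖tiltedMatrix P φ *ᵥ u - c • u‖ + ‖u - 1‖ + ‖u - 1‖ := norm_sub_le_of_le hJu (hJ n _)
    _ = n * ‖tiltedMatrix P φ *ᵥ u - c • u‖ + 2 * ‖u - 1‖ := by ring

end CharacteristicFunction

section CentralLimitTheorem

theorem isBigO_cexp_mul_quadratic (a b p q : ℂ) :
    (fun s : ℝ => Complex.exp (a * s + b * s ^ 2) * (1 + p * s + q * s ^ 2)
      - (1 + (a + p) * s + (b + a ^ 2 / 2 + a * p + q) * s ^ 2)) =O[𝓝 0] fun s => s ^ 3 := by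
  have hcont {g : ℝ → ℂ} (hg : Continuous g) : g =O[𝓝 0] fun _ => (1 : ℝ) :=
    (hg.tendsto 0).isBigO_one ℝ
  have hid : (fun s : ℝ => (s : ℂ)) =O[𝓝 0] fun s : ℝ => s :=
    .of_norm_left (by simpa only [Complex.norm_real] using (Asymptotics.isBigO_refl _ _).norm_left)
  have hexp : (fun s : ℝ => Complex.exp (a * s + b * s ^ 2)
      - (1 + (a * s + b * s ^ 2) + (a * s + b * s ^ 2) ^ 2 / 2)) =O[𝓝 0] fun s => s ^ 3 := by
    have hz : Tendsto (fun s : ℝ => a * s + b * s ^ 2) (𝓝 0) (𝓝 0) :=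
      Continuous.tendsto' (by fun_prop) 0 0 (by simp)
    have hzO : (fun s : ℝ => a * s + b * s ^ 2) =O[𝓝 0] fun s : ℝ => s := by
      simpa only [mul_one, mul_add, mul_left_comm, sq, mul_comm] using
        hid.mul (hcont (g := fun s => a + b * s) (by fun_prop))
    have htaylor := (Complex.exp_sub_sum_range_isBigO_pow 3).comp_tendsto hz
    simp only [Function.comp_def, Finset.sum_range_succ, Finset.sum_range_zero, zero_add, pow_zero,
      pow_one, Nat.factorial, Nat.cast_one, div_one, mul_one] at htaylor
    exact htaylor.trans (hzO.pow 3)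
  have hmul := hexp.mul (hcont (g := fun s => 1 + p * s + q * s ^ 2) (by fun_prop))
  have hrest := (hid.pow 3).mul (hcont (g := fun s => a * b + (b + a ^ 2 / 2) * p + a * q
    + (b ^ 2 / 2 + a * b * p + (b + a ^ 2 / 2) * q) * s + (b ^ 2 / 2 * p + a * b * q) * s ^ 2
    + b ^ 2 / 2 * q * s ^ 3) (by fun_prop))
  simp only [mul_one] at hmul hrest
  refine (hmul.add hrest).congr_left fun s => ?_
  ring

variable {S : Type*} [Fintype S] [DecidableEq S] {P : Matrix S S ℝ} {h f k : S → ℝ} {v : ℝ}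

theorem sum_mul_corrector (hrow : P *ᵥ 1 = 1) (hf : (P - 1) *ᵥ h = f)
    (hk : ∀ x, ((P - 1) *ᵥ k) x = (h x ^ 2 - (P *ᵥ h) x ^ 2 - v) / 2) (x : S) (s : ℝ) :
    ∑ t, (P x t : ℂ) * (1 + -(h t * Complex.I) * s + k t * s ^ 2)
      = 1 + (-(f x * Complex.I) + -(h x * Complex.I)) * s
        + (-(v / 2) + (-(f x * Complex.I)) ^ 2 / 2 + -(f x * Complex.I) * -(h x * Complex.I) + k x)
          * s ^ 2 := by
  have hcast (w : S → ℝ) : ∑ t, (P x t : ℂ) * w t = ((P *ᵥ w) x : ℝ) := by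
    simp only [mulVec, dotProduct, Complex.ofReal_sum, Complex.ofReal_mul]
  have hone : ∑ t, (P x t : ℂ) * 1 = 1 := by
    simpa only [hrow, Pi.one_apply, Complex.ofReal_one] using hcast 1
  have hPh : (P *ᵥ h) x = h x + f x := by
    rw [← hf, sub_mulVec, one_mulVec, Pi.sub_apply, add_sub_cancel]
  have hPk : (P *ᵥ k) x = k x - f x ^ 2 / 2 - f x * h x - v / 2 := by
    have hkx := hk x
    rw [sub_mulVec, one_mulVec, Pi.sub_apply, hPh] at hkx
    linarith
  calc ∑ t, (P x t : ℂ) * (1 + -(h t * Complex.I) * s + k t * s ^ 2)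
      = ∑ t, (P x t : ℂ) * 1 - Complex.I * s * ∑ t, (P x t : ℂ) * h t
          + s ^ 2 * ∑ t, (P x t : ℂ) * k t := by
        simp only [Finset.mul_sum, ← Finset.sum_add_distrib, ← Finset.sum_sub_distrib]
        exact Finset.sum_congr rfl fun t _ => by ring
    _ = _ := by
        rw [hone, hcast, hcast, hPh, hPk]
        push_cast
        linear_combination (-(f x ^ 2 / 2 : ℂ) - f x * h x) * s ^ 2 * Complex.I_sq

theorem exists_isBigO_tiltedMatrix_mulVec_sub (hrow : P *ᵥ 1 = 1) (hf : (P - 1) *ᵥ h = f)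
    (hk : ∀ x, ((P - 1) *ᵥ k) x = (h x ^ 2 - (P *ᵥ h) x ^ 2 - v) / 2) :
    ∃ u : ℝ → S → ℂ, ((fun s => u s - 1) =O[𝓝 0] fun s => s) ∧
      (fun s : ℝ => tiltedMatrix P (fun x => Complex.exp (s * f x * Complex.I)) *ᵥ u s
        - Complex.exp (-(v * s ^ 2 / 2)) • u s) =O[𝓝 0] fun s => s ^ 3 := by
  refine ⟨fun s => (fun x => Complex.exp (-(f x * Complex.I) * s))
    * fun x => 1 + -(h x * Complex.I) * s + k x * s ^ 2, ?_, ?_⟩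
  · refine Asymptotics.isBigO_pi.2 fun x => ?_
    have hdiff : DifferentiableAt ℝ (fun s : ℝ => Complex.exp (-(f x * Complex.I) * s)
        * (1 + -(h x * Complex.I) * s + k x * s ^ 2)) 0 := by fun_prop
    simpa using hdiff.isBigO_sub
  · refine Asymptotics.isBigO_pi.2 fun x => .of_neg_left ?_
    refine (isBigO_cexp_mul_quadratic (-(f x * Complex.I)) (-(v / 2)) (-(h x * Complex.I))
      (k x)).congr_left fun s => ?_
    have hinv : (fun x => Complex.exp (s * f x * Complex.I))
        * (fun x => Complex.exp (-(f x * Complex.I) * s)) = 1 := funext fun x => by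
      rw [Pi.mul_apply, ← Complex.exp_add, Pi.one_apply]
      ring_nf
      exact Complex.exp_zero
    rw [Pi.sub_apply, tiltedMatrix_mulVec_mul_apply P hinv]
    refine Eq.trans ?_ (congrArg _ (congrArg (· - _) (sum_mul_corrector hrow hf hk x s).symm))
    simp only [Pi.smul_apply, Pi.mul_apply, smul_eq_mul, neg_sub, ← mul_assoc, ← Complex.exp_add]
    ring_nf

theorem exists_tendsto_tiltedMatrix_mulVec_sub (hrow : P *ᵥ 1 = 1) (hf : (P - 1) *ᵥ h = f)
    (hk : ∀ x, ((P - 1) *ᵥ k) x = (h x ^ 2 - (P *ᵥ h) x ^ 2 - v) / 2) :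
    ∃ u : ℕ → S → ℂ, Tendsto (fun n : ℕ =>
      n * ‖tiltedMatrix P (fun x => Complex.exp ((√n)⁻¹ * f x * Complex.I)) *ᵥ u n
        - Complex.exp (-(v / 2) / n) • u n‖ + 2 * ‖u n - 1‖) atTop (𝓝 0) := by
  obtain ⟨u, hu, hLu⟩ := exists_isBigO_tiltedMatrix_mulVec_sub hrow hf hk
  refine ⟨fun n => u (√n)⁻¹, ?_⟩
  have hs : Tendsto (fun n : ℕ => (√n)⁻¹) atTop (𝓝 0) :=
    tendsto_inv_atTop_zero.comp (Real.tendsto_sqrt_atTop.comp tendsto_natCast_atTop_atTop)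
  have hsq (n : ℕ) : (√n)⁻¹ ^ 2 = (n : ℝ)⁻¹ := by rw [inv_pow, Real.sq_sqrt (Nat.cast_nonneg n)]
  have hcube (n : ℕ) : (n : ℝ) * (√n)⁻¹ ^ 3 = (√n)⁻¹ := by
    obtain rfl | hn := eq_or_ne n 0
    · simp
    · rw [pow_succ, hsq, mul_inv_cancel_left₀ (Nat.cast_ne_zero.2 hn)]
  have hexponent (n : ℕ) : -((v : ℂ) * (√n : ℂ)⁻¹ ^ 2 / 2) = -(v / 2) / n := by
    rw [← Complex.ofReal_inv, ← Complex.ofReal_pow, hsq]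
    push_cast
    ring
  have hdefect := ((Asymptotics.isBigO_refl (fun n : ℕ => (n : ℝ)) atTop).mul
    (hLu.comp_tendsto hs).norm_left).trans_tendsto
    (by simpa only [Function.comp_apply, hcube] using hs)
  have hboundary := ((hu.comp_tendsto hs).trans_tendsto hs).norm.const_mul 2
  simpa only [Function.comp_apply, hexponent, Complex.ofReal_inv, norm_zero, mul_zero, add_zero]
    using hdefect.add hboundary

namespace IsMarkovChain

variable {X : Type*} [MeasurableSpace X] [MeasurableSpace S] [MeasurableSingletonClass S]
  {ν : Measure X} [IsProbabilityMeasure ν] {τ : ℕ → X → S} {p₀ : S → ℝ}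

theorem tendsto_integral_cexp_sum (hτ : IsMarkovChain ν τ p₀ P) (hrow : P *ᵥ 1 = 1)
    (hf : (P - 1) *ᵥ h = f)
    (hk : ∀ x, ((P - 1) *ᵥ k) x = (h x ^ 2 - (P *ᵥ h) x ^ 2 - v) / 2) (hv : 0 ≤ v) :
    Tendsto (fun n : ℕ => ∫ ω, Complex.exp
      (((√n)⁻¹ * ∑ j ∈ Finset.Icc 1 n, f (τ j ω) : ℝ) * Complex.I) ∂ν) atTop
      (𝓝 (Complex.exp (-(v / 2)))) := by
  obtain ⟨u, hu⟩ := exists_tendsto_tiltedMatrix_mulVec_sub hrow hf hk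
  refine tendsto_iff_norm_sub_tendsto_zero.2
    (squeeze_zero' (.of_forall fun _ => norm_nonneg _) ?_ hu)
  filter_upwards [eventually_ne_atTop 0] with n hn
  have hprod (ω : X) : Complex.exp (((√n)⁻¹ * ∑ j ∈ Finset.Icc 1 n, f (τ j ω) : ℝ) * Complex.I)
      = ∏ j ∈ Finset.Icc 1 n, Complex.exp ((√n)⁻¹ * f (τ j ω) * Complex.I) := by
    rw [← Complex.exp_sum, ← Finset.sum_mul, ← Finset.mul_sum]
    push_cast
    rfl
  have hpow : Complex.exp (-(v / 2) / n) ^ n = Complex.exp (-(v / 2)) := by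
    rw [← Complex.exp_nat_mul, mul_div_cancel₀ _ (Nat.cast_ne_zero.2 hn)]
  rw [← hpow]
  simp only [hprod]
  refine hτ.norm_integral_prod_sub_pow_le
    (φ := fun x => Complex.exp ((√n)⁻¹ * f x * Complex.I)) (fun x => ?_) ?_ (u n) n
  · exact_mod_cast (Complex.norm_exp_ofReal_mul_I ((√n)⁻¹ * f x)).le
  · have hreal : (-(v / 2) / n : ℂ) = (-(v / 2) / n : ℝ) := by push_cast; rfl
    rw [hreal, Complex.norm_exp_ofReal, Real.exp_le_one_iff]
    exact div_nonpos_of_nonpos_of_nonneg (by linarith) (Nat.cast_nonneg n)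

theorem tendstoInDistribution_sum (hτ : IsMarkovChain ν τ p₀ P) (hP : P ∈ doublyStochastic ℝ S)
    (hirr : P.IsIrreducible) {ι : Type*} [Fintype ι] [DecidableEq ι] {V : Matrix ι ι ℝ}
    (hV : V.PosSemidef) (F : S → EuclideanSpace ℝ ι)
    (hF : ∀ t : EuclideanSpace ℝ ι, ∃ h, (P - 1) *ᵥ h = (fun x => inner ℝ (F x) t) ∧
      asymptoticVariance P h = t ⬝ᵥ V *ᵥ t) :
    TendstoInDistribution (fun (n : ℕ) ω => (1 / √(n : ℝ)) • ∑ j ∈ Finset.Icc 1 n, F (τ j ω)) atTop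
      (id : EuclideanSpace ℝ ι → EuclideanSpace ℝ ι) (fun _ => ν) (multivariateGaussian 0 V) := by
  have hmeas (n : ℕ) : AEMeasurable (fun ω =>
      (1 / √(n : ℝ)) • ∑ j ∈ Finset.Icc 1 n, F (τ j ω)) ν := by
    have hFτ (j : ℕ) : Measurable fun ω => F (τ j ω) :=
      (measurable_of_finite F).comp (hτ.measurable j)
    exact ((Finset.measurable_fun_sum _ fun j _ => hFτ j).const_smul (1 / √(n : ℝ))).aemeasurable
  refine ⟨hmeas, aemeasurable_id, ProbabilityMeasure.tendsto_iff_tendsto_charFun.2 fun t => ?_⟩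
  obtain ⟨h, hf, hvar⟩ := hF t
  obtain ⟨k, hk⟩ := exists_second_corrector hP hirr h
  have hlim := hτ.tendsto_integral_cexp_sum (mem_doublyStochastic.1 hP).2.1 hf hk
    (asymptoticVariance_nonneg hP h)
  simp only [ProbabilityMeasure.coe_mk, Measure.map_id]
  rw [charFun_multivariateGaussian hV, ← hvar, inner_zero_right, Complex.ofReal_zero, zero_mul,
    zero_sub]
  refine hlim.congr fun n => ?_
  rw [charFun_apply, integral_map (hmeas n) (by fun_prop)]
  simp only [real_inner_smul_left, sum_inner, one_div]

end IsMarkovChain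

end CentralLimitTheorem

section RandomMaps

theorem path_eq_iff {S X : Type*} {τ : ℕ → X → S} {G : ℕ → X → S → S}
    (hτ : ∀ k ω, τ (k + 1) ω = G k ω (τ k ω)) (n : ℕ) (s : ℕ → S) (ω : X) :
    (∀ k ≤ n, τ k ω = s k) ↔ τ 0 ω = s 0 ∧ ∀ k ∈ Finset.range n, G k ω (s k) = s (k + 1) := by
  simp only [Finset.mem_range]
  refine ⟨fun h => ⟨h 0 n.zero_le, fun k hk => ?_⟩, fun h k hk => ?_⟩
  · rw [← h k hk.le, ← hτ, h (k + 1) hk]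
  · induction k with
    | zero => exact h.1
    | succ k ih => rw [hτ, ih (Nat.le_of_succ_le hk), h.2 k hk]

variable {S X : Type*} [Finite S] [MeasurableSpace S] [MeasurableSingletonClass S]
  [MeasurableSpace X] {ν : Measure X} {τ : ℕ → X → S} {G : ℕ → X → S → S}

theorem measure_path_eq_prod (hG : iIndepFun G ν) (hτ : ∀ k ω, τ (k + 1) ω = G k ω (τ k ω))
    (hτG : IndepFun (τ 0) (fun ω k => G k ω) ν) (n : ℕ) (s : ℕ → S) :
    ν {ω | ∀ k ≤ n, τ k ω = s k}
      = ν {ω | τ 0 ω = s 0} * ∏ k ∈ Finset.range n, ν {ω | G k ω (s k) = s (k + 1)} := by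
  have hstep (k : ℕ) : MeasurableSet {g : S → S | g (s k) = s (k + 1)} :=
    (Set.toFinite _).measurableSet
  have hsteps : MeasurableSet {g : ℕ → S → S | ∀ k ∈ Finset.range n, g k (s k) = s (k + 1)} := by
    simp only [Set.ofPred_forall]
    exact .iInter fun k => .iInter fun _ =>
      (measurable_pi_apply k : Measurable fun g : ℕ → S → S => g k) (hstep k)
  have hfactor := hG.measure_inter_preimage_eq_mul (Finset.range n) fun k _ => hstep k
  simp only [path_eq_iff hτ, Set.ofPred_and]
  refine (hτG.measure_inter_preimage_eq_mul {s 0} _ (measurableSet_singleton _) hsteps).trans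
    (congrArg _ (Eq.trans (congrArg ν ?_) hfactor))
  simp only [Set.preimage_ofPred_eq, Set.ofPred_forall, Set.preimage_iInter]

theorem isMarkovChain_of_randomMap [IsFiniteMeasure ν] (hGmeas : ∀ k, Measurable (G k))
    (hG : iIndepFun G ν) (hτ0 : Measurable (τ 0)) (hτ : ∀ k ω, τ (k + 1) ω = G k ω (τ k ω))
    (hτG : IndepFun (τ 0) (fun ω k => G k ω) ν) {P : Matrix S S ℝ}
    (hP : ∀ k x y, ν.real {ω | G k ω x = y} = P x y) :
    IsMarkovChain ν τ (fun s => ν.real {ω | τ 0 ω = s}) P := by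
  have hmeas (n : ℕ) : Measurable (τ n) := by
    induction n with
    | zero => exact hτ0
    | succ n ih =>
      rw [funext (hτ n)]
      exact (measurable_of_finite fun p : (S → S) × S => p.1 p.2).comp ((hGmeas n).prodMk ih)
  refine ⟨hmeas, fun _ => rfl, fun n s t hne => ?_⟩
  have hsucc (s : ℕ → S) : ν {ω | ∀ k ≤ n + 1, τ k ω = s k}
      = ν {ω | ∀ k ≤ n, τ k ω = s k} * ν {ω | G n ω (s n) = s (n + 1)} := by
    rw [measure_path_eq_prod hG hτ hτG, measure_path_eq_prod hG hτ hτG, Finset.prod_range_succ,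
      mul_assoc]
  have hpast : {ω | ∀ k ≤ n, τ k ω = Function.update s (n + 1) t k}
      = {ω | ∀ k ≤ n, τ k ω = s k} := by grind
  have hext : {ω | ∀ k ≤ n + 1, τ k ω = Function.update s (n + 1) t k}
      = {ω | ∀ k ≤ n, τ k ω = s k} ∩ {ω | τ (n + 1) ω = t} := by
    rw [← hpast]
    ext ω
    simp only [Nat.le_succ_iff, or_imp, forall_and, forall_eq,
      Function.update_self, Set.mem_inter_iff, Set.mem_ofPred_eq]
  have hmul := hsucc (Function.update s (n + 1) t)
  rw [hext, hpast, Function.update_self, Function.update_of_ne n.lt_succ_self.ne] at hmul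
  rw [← hP n, measureReal_def, measureReal_def, cond_apply (measurableSet_path hmeas n s), hmul,
    ENNReal.inv_mul_cancel_left hne (measure_ne_top _ _)]

end RandomMaps

section CoinSpace

variable {d : ℕ}

theorem card_coinIndex (d : ℕ) : Fintype.card (CoinIndex d) = 2 * d := by
  rw [Fintype.card_coe, Finset.card_erase_of_mem (by simp), Int.card_Icc]
  omega

theorem inv_card_coinIndex (d : ℕ) :
    (Fintype.card (CoinIndex d) : ℝ)⁻¹ = 1 / (2 * d : ℝ) := by
  rw [card_coinIndex, one_div, Nat.cast_mul, Nat.cast_ofNat]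

theorem projQ_eq_meanZeroProj (d : ℕ) : projQ d = meanZeroProj (CoinIndex d) := by
  rw [projQ, meanZeroProj, inv_card_coinIndex]

variable {P : Matrix (CoinIndex d) (CoinIndex d) ℝ}
  (hP : P ∈ doublyStochastic ℝ (CoinIndex d)) (hirr : P.IsIrreducible)

include hP hirr

theorem isUnit_projQ_compression_sub_one : IsUnit (projQ d * P * projQ d - 1) := by
  rw [projQ_eq_meanZeroProj]
  exact isUnit_meanZeroProj_compression_sub_one hP hirr

theorem sub_one_mul_reducedResolvent : (P - 1) * reducedResolvent P = projQ d := by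
  rw [reducedResolvent, projQ_eq_meanZeroProj]
  exact sub_one_mul_inv_mul isIdempotentElem_meanZeroProj (meanZeroProj_mul_sub_one hP)
    (sub_one_mul_meanZeroProj hP) (isUnit_meanZeroProj_compression_sub_one hP hirr)

theorem reducedResolvent_mul_sub_one : reducedResolvent P * (P - 1) = projQ d := by
  rw [reducedResolvent, projQ_eq_meanZeroProj]
  exact inv_mul_mul_sub_one isIdempotentElem_meanZeroProj (meanZeroProj_mul_sub_one hP)
    (sub_one_mul_meanZeroProj hP) (isUnit_meanZeroProj_compression_sub_one hP hirr)

theorem projQ_mul_reducedResolvent : projQ d * reducedResolvent P = reducedResolvent P := by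
  rw [reducedResolvent, projQ_eq_meanZeroProj]
  exact mul_inv_mul isIdempotentElem_meanZeroProj (meanZeroProj_mul_sub_one hP)
    (sub_one_mul_meanZeroProj hP) (isUnit_meanZeroProj_compression_sub_one hP hirr)

theorem asymptoticVariance_reducedResolvent_mulVec (c : CoinIndex d → ℝ) :
    asymptoticVariance P (reducedResolvent P *ᵥ c)
      = -(1 / (2 * d : ℝ)) * (c ⬝ᵥ projQ d *ᵥ c + 2 * (c ⬝ᵥ reducedResolvent P *ᵥ c)) := by
  have hpoisson : (P - 1) *ᵥ (reducedResolvent P *ᵥ c) = projQ d *ᵥ c := by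
    rw [mulVec_mulVec, sub_one_mul_reducedResolvent hP hirr]
  have hsymm (v : CoinIndex d → ℝ) : (projQ d *ᵥ c) ⬝ᵥ v = c ⬝ᵥ projQ d *ᵥ v := by
    rw [projQ_eq_meanZeroProj, meanZeroProj_mulVec_dotProduct]
  have hidem : projQ d * projQ d = projQ d := by
    rw [projQ_eq_meanZeroProj, isIdempotentElem_meanZeroProj.eq]
  rw [asymptoticVariance_of_sub_one_mulVec_eq hpoisson, inv_card_coinIndex, hsymm, hsymm,
    mulVec_mulVec, mulVec_mulVec, hidem, projQ_mul_reducedResolvent hP hirr]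

end CoinSpace

section Covariance

variable {d : ℕ} (r : CoinIndex d → Fin d → ℤ) {P : Matrix (CoinIndex d) (CoinIndex d) ℝ}

theorem drift_eq : drift r = (Fintype.card (CoinIndex d) : ℝ)⁻¹ • ∑ x, jumpVec r x := by
  rw [drift, inv_card_coinIndex]

theorem drift_apply (i : Fin d) : drift r i = 1 / (2 * d : ℝ) * ∑ x, jumpComp r i x := by
  simp [drift, jumpVec, jumpComp]

theorem inner_jumpVec_sub_drift (t : EuclideanSpace ℝ (Fin d)) (x : CoinIndex d) :
    inner ℝ (jumpVec r x - drift r) t = (projQ d *ᵥ ((of (jumpComp r))ᵀ *ᵥ t)) x := by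
  have hinner (y : CoinIndex d) : inner ℝ (jumpVec r y) t = ((of (jumpComp r))ᵀ *ᵥ t) y := by
    simp [PiLp.inner_apply, jumpVec, jumpComp, mulVec, dotProduct, mul_comm]
  rw [projQ_eq_meanZeroProj, meanZeroProj_mulVec_apply, drift_eq, inner_sub_left, hinner,
    real_inner_smul_left, sum_inner]
  simp only [hinner]

theorem covMatrix_eq (P : Matrix (CoinIndex d) (CoinIndex d) ℝ) :
    covMatrix r P = -(1 / (2 * d : ℝ)) • (of (jumpComp r)
      * (projQ d + reducedResolvent P + (reducedResolvent P)ᵀ) * (of (jumpComp r))ᵀ) := by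
  ext i j
  have hproj : jumpComp r i ⬝ᵥ projQ d *ᵥ jumpComp r j = jumpComp r i ⬝ᵥ jumpComp r j
      - (∑ x, jumpComp r i x) * (1 / (2 * d : ℝ) * ∑ x, jumpComp r j x) := by
    simp only [projQ_eq_meanZeroProj, dotProduct, meanZeroProj_mulVec_apply, inv_card_coinIndex,
      mul_sub, Finset.sum_sub_distrib, Finset.sum_mul]
  have hentry (M : Matrix (CoinIndex d) (CoinIndex d) ℝ) :
      (of (jumpComp r) * M * (of (jumpComp r))ᵀ) i j = jumpComp r i ⬝ᵥ M *ᵥ jumpComp r j := by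
    rw [Matrix.mul_assoc]
    rfl
  rw [covMatrix, of_apply, drift_apply, drift_apply, Matrix.smul_apply, hentry]
  simp only [add_mulVec, dotProduct_add, hproj, smul_eq_mul, dotProduct_transpose_mulVec]
  ring

theorem dotProduct_covMatrix_mulVec (hP : P ∈ doublyStochastic ℝ (CoinIndex d))
    (hirr : P.IsIrreducible) (t : Fin d → ℝ) :
    t ⬝ᵥ covMatrix r P *ᵥ t
      = asymptoticVariance P (reducedResolvent P *ᵥ ((of (jumpComp r))ᵀ *ᵥ t)) := by
  rw [asymptoticVariance_reducedResolvent_mulVec hP hirr, covMatrix_eq, smul_mulVec,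
    dotProduct_smul, ← mulVec_mulVec, ← mulVec_mulVec, dotProduct_mulVec, ← mulVec_transpose,
    add_mulVec, add_mulVec, dotProduct_add, dotProduct_add, dotProduct_transpose_mulVec, add_assoc,
    ← two_mul, smul_eq_mul]

theorem posSemidef_covMatrix (hP : P ∈ doublyStochastic ℝ (CoinIndex d))
    (hirr : P.IsIrreducible) : (covMatrix r P).PosSemidef := by
  refine .of_dotProduct_mulVec_nonneg (Matrix.ext fun i j => ?_) fun t => ?_
  · simp only [conjTranspose_apply, star_trivial, covMatrix, of_apply]
    rw [dotProduct_comm (jumpComp r j) (jumpComp r i)]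
    ring
  · rw [star_trivial, dotProduct_covMatrix_mulVec r hP hirr]
    exact asymptoticVariance_nonneg hP _

theorem IsMarkovChain.tendstoInDistribution_sum_jumpVec {X : Type*} [MeasurableSpace X]
    {ν : Measure X} [IsProbabilityMeasure ν] {τ : ℕ → X → CoinIndex d} {p₀ : CoinIndex d → ℝ}
    (hτ : IsMarkovChain ν τ p₀ P) (hP : P ∈ doublyStochastic ℝ (CoinIndex d))
    (hirr : P.IsIrreducible) :
    TendstoInDistribution (fun (n : ℕ) ω => (1 / √(n : ℝ)) •
        ∑ j ∈ Finset.Icc 1 n, (jumpVec r (τ j ω) - drift r))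
      atTop (id : EuclideanSpace ℝ (Fin d) → EuclideanSpace ℝ (Fin d)) (fun _ => ν)
      (multivariateGaussian 0 (covMatrix r P)) := by
  refine hτ.tendstoInDistribution_sum hP hirr (posSemidef_covMatrix r hP hirr)
    (fun x => jumpVec r x - drift r) fun t =>
      ⟨_, ?_, (dotProduct_covMatrix_mulVec r hP hirr t).symm⟩
  rw [mulVec_mulVec, sub_one_mul_reducedResolvent hP hirr]
  exact funext fun x => (inner_jumpVec_sub_drift r t x).symm

end Covariance

section RandomPermutation

variable {d : ℕ}

theorem measurable_coinMatrix_apply (σ τ : CoinIndex d) :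
    Measurable fun M : Matrix (CoinIndex d) (CoinIndex d) ℂ => M σ τ :=
  (measurable_pi_apply τ).comp (measurable_pi_apply σ)

/-- The permutation part `π` of a phased permutation matrix `C(π, Θ)`, recovered from the positions
of the nonzero entries. It is regarded as a map, so that it takes values in a product measurable
space. -/
noncomputable def permPart (M : Matrix (CoinIndex d) (CoinIndex d) ℂ) :
    CoinIndex d → CoinIndex d :=
  ⇑(Classical.epsilon fun p : Equiv.Perm (CoinIndex d) => ∀ σ τ, M σ τ ≠ 0 ↔ σ = p τ)

theorem measurable_permPart : Measurable (permPart (d := d)) := by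
  have hsupp : Measurable fun (M : Matrix (CoinIndex d) (CoinIndex d) ℂ) σ τ => M σ τ ≠ 0 :=
    measurable_pi_lambda _ fun σ => measurable_pi_lambda _ fun τ => measurableSet_setOfPred.1
      (measurable_coinMatrix_apply σ τ (measurableSet_singleton 0).compl)
  exact (measurable_of_finite fun A : CoinIndex d → CoinIndex d → Prop =>
    ⇑(Classical.epsilon fun p : Equiv.Perm (CoinIndex d) => ∀ σ τ, A σ τ ↔ σ = p τ)).comp hsupp

theorem permPart_phasedPerm (p : Equiv.Perm (CoinIndex d)) (Θ : CoinIndex d → ℝ) :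
    permPart (phasedPerm p Θ) = p := by
  have hsupp (σ τ : CoinIndex d) : phasedPerm p Θ σ τ ≠ 0 ↔ σ = p τ := by
    simp [phasedPerm, Complex.exp_ne_zero]
  have hperm := Classical.epsilon_spec
    (p := fun q : Equiv.Perm (CoinIndex d) => ∀ σ τ, phasedPerm p Θ σ τ ≠ 0 ↔ σ = q τ) ⟨p, hsupp⟩
  ext1 τ
  exact ((hperm _ τ).1 ((hsupp _ τ).2 rfl)).symm

theorem measurableSet_exists_eq_phasedPerm (p : Equiv.Perm (CoinIndex d)) :
    MeasurableSet {M : Matrix (CoinIndex d) (CoinIndex d) ℂ | ∃ Θ, M = phasedPerm p Θ} := by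
  have hentries (M : Matrix (CoinIndex d) (CoinIndex d) ℂ) :
      (∃ Θ, M = phasedPerm p Θ) ↔ ∀ σ τ, M σ τ ∈ if σ = p τ then Metric.sphere 0 1 else {0} := by
    refine ⟨?_, fun hM => ?_⟩
    · rintro ⟨Θ, rfl⟩ σ τ
      by_cases hσ : σ = p τ <;> simp [phasedPerm, hσ, mul_comm Complex.I]
    · refine ⟨fun σ => (M σ (p.symm σ)).arg, Matrix.ext fun σ τ => ?_⟩
      have hστ := hM σ τ
      by_cases hσ : σ = p τ
      · subst hσ
        rw [if_pos rfl, mem_sphere_zero_iff_norm] at hστ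
        have hpolar := Complex.norm_mul_exp_arg_mul_I (M (p τ) τ)
        rw [hστ, Complex.ofReal_one, one_mul, mul_comm] at hpolar
        simp [phasedPerm, hpolar]
      · simpa [phasedPerm, hσ] using hστ
  simp only [hentries, Set.ofPred_forall]
  refine .iInter fun σ => .iInter fun τ => ?_
  refine measurable_coinMatrix_apply σ τ ?_
  split_ifs
  exacts [Metric.isClosed_sphere.measurableSet, measurableSet_singleton 0]

theorem permPart_eq {X : Type*} {C : X → Matrix (CoinIndex d) (CoinIndex d) ℂ}
    {π : X → Equiv.Perm (CoinIndex d)} (hπ : ∀ ω, ∃ Θ, C ω = phasedPerm (π ω) Θ) (ω : X) :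
    permPart (C ω) = π ω := by
  obtain ⟨Θ, hΘ⟩ := hπ ω
  rw [hΘ, permPart_phasedPerm]

variable {X : Type*} [MeasurableSpace X] {ν : Measure X}
  {C : X → Matrix (CoinIndex d) (CoinIndex d) ℂ} {π : X → Equiv.Perm (CoinIndex d)}

theorem measurable_perm (hC : Measurable C) (hπ : ∀ ω, ∃ Θ, C ω = phasedPerm (π ω) Θ) :
    Measurable fun ω => ⇑(π ω) := by
  simpa only [Function.comp_def, permPart_eq hπ] using measurable_permPart.comp hC

theorem permLaw_eq (hπ : ∀ ω, ∃ Θ, C ω = phasedPerm (π ω) Θ) (p : Equiv.Perm (CoinIndex d)) :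
    permLaw ν C p = ν.real (π ⁻¹' {p}) := by
  refine congrArg ν.real (Set.ext fun ω => ⟨fun ⟨Θ, hΘ⟩ => ?_, fun h => h ▸ hπ ω⟩)
  exact DFunLike.coe_injective ((permPart_eq hπ ω).symm.trans (hΘ ▸ permPart_phasedPerm p Θ))

theorem measurableSet_preimage_perm (hC : Measurable C) (hπ : ∀ ω, ∃ Θ, C ω = phasedPerm (π ω) Θ)
    (p : Equiv.Perm (CoinIndex d)) : MeasurableSet (π ⁻¹' {p}) := by
  have hcoe : π ⁻¹' {p} = (fun ω => ⇑(π ω)) ⁻¹' {⇑p} :=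
    Set.ext fun ω => DFunLike.coe_injective.eq_iff.symm
  exact hcoe ▸ measurable_perm hC hπ (measurableSet_singleton _)

theorem transitionMatrix_apply [IsFiniteMeasure ν] (hC : Measurable C)
    (hπ : ∀ ω, ∃ Θ, C ω = phasedPerm (π ω) Θ) (x y : CoinIndex d) :
    transitionMatrix ν C x y = ν.real {ω | π ω x = y} := by
  simp only [transitionMatrix, of_apply, permLaw_eq hπ, mul_ite, mul_one, mul_zero,
    ← Finset.sum_filter]
  rw [sum_measureReal_preimage_singleton _ fun p _ => measurableSet_preimage_perm hC hπ p]
  exact congrArg ν.real (Set.ext fun ω => by simp [eq_comm])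

theorem transitionMatrix_mem_doublyStochastic [IsProbabilityMeasure ν] (hC : Measurable C)
    (hπ : ∀ ω, ∃ Θ, C ω = phasedPerm (π ω) Θ) :
    transitionMatrix ν C ∈ doublyStochastic ℝ (CoinIndex d) := by
  have hconvex : transitionMatrix ν C = ∑ p, permLaw ν C p • p.permMatrix ℝ := by
    ext x y
    simp [transitionMatrix, Matrix.sum_apply, Equiv.Perm.permMatrix, PEquiv.toMatrix_apply, eq_comm]
  have hsum : ∑ p, permLaw ν C p = 1 := by
    simp only [permLaw_eq hπ]
    rw [sum_measureReal_preimage_singleton _ fun p _ => measurableSet_preimage_perm hC hπ p]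
    simp
  rw [hconvex]
  exact convex_doublyStochastic.sum_mem (fun p _ => measureReal_nonneg) hsum
    fun p _ => permMatrix_mem_doublyStochastic

theorem integral_phasedPerm_zero_transpose [IsFiniteMeasure ν] (hC : Measurable C)
    (hπ : ∀ ω, ∃ Θ, C ω = phasedPerm (π ω) Θ) (x y : CoinIndex d) :
    ∫ ω, (phasedPerm (π ω) 0)ᵀ x y ∂ν = (transitionMatrix ν C x y : ℂ) := by
  have hsum := integral_comp_eq_sum (ν := ν) ((measurable_pi_apply x).comp (measurable_perm hC hπ))
    fun z => if y = z then (1 : ℂ) else 0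
  simpa [phasedPerm, transitionMatrix_apply hC hπ] using hsum

theorem transitionMatrix_eq_of_identDistrib {C' : X → Matrix (CoinIndex d) (CoinIndex d) ℂ}
    (h : IdentDistrib C C' ν ν) : transitionMatrix ν C = transitionMatrix ν C' := by
  have hlaw (p : Equiv.Perm (CoinIndex d)) : permLaw ν C p = permLaw ν C' p :=
    congrArg ENNReal.toReal (h.measure_mem_eq (measurableSet_exists_eq_phasedPerm p))
  simp only [transitionMatrix, hlaw]

end RandomPermutation

section CoinPath

variable {d : ℕ} {X : Type*} [MeasurableSpace X] {ν : Measure X} [IsFiniteMeasure ν]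
  {C : ℕ → X → Matrix (CoinIndex d) (CoinIndex d) ℂ} {π : ℕ → X → Equiv.Perm (CoinIndex d)}

theorem isMarkovChain_coinPath (hC : ∀ k, Measurable (C k)) (hindep : iIndepFun C ν)
    (hident : ∀ k, IdentDistrib (C k) (C 0) ν ν)
    (hπ : ∀ k ω, ∃ Θ, C k ω = phasedPerm (π k ω) Θ) {τ₀ : X → CoinIndex d}
    (hτ₀ : Measurable τ₀) (hτ₀C : IndepFun τ₀ (fun ω k => C k ω) ν) :
    IsMarkovChain ν (coinPath τ₀ π) (fun σ => ν.real {ω | τ₀ ω = σ})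
      (transitionMatrix ν (C 0)) := by
  have hpart : (fun k => permPart ∘ C k) = fun k ω => ⇑(π k ω) :=
    funext fun k => funext (permPart_eq (hπ k))
  have hperms : Measurable fun (M : ℕ → Matrix (CoinIndex d) (CoinIndex d) ℂ) k => permPart (M k) :=
    measurable_pi_lambda _ fun k => measurable_permPart.comp (measurable_pi_apply k)
  refine isMarkovChain_of_randomMap (τ := coinPath τ₀ π) (G := fun k ω => ⇑(π k ω))
    (fun k => measurable_perm (hC k) (hπ k))
    (hpart ▸ hindep.comp _ fun _ => measurable_permPart) hτ₀ (fun _ _ => rfl) ?_ fun k x y => ?_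
  · simpa only [Function.comp_def, permPart_eq (hπ _), id_eq] using! hτ₀C.comp measurable_id hperms
  · rw [← transitionMatrix_apply (hC k) (hπ k), transitionMatrix_eq_of_identDistrib (hident k)]

end CoinPath

end QuantumWalk

theorem mainTheorem6 {d : ℕ} (r : QuantumWalk.CoinIndex d → Fin d → ℤ)
    {X : Type*} [MeasurableSpace X] (ν : Measure X) [IsProbabilityMeasure ν]
    -- the i.i.d. random phased permutation matrices `C_1 = C 0, C_2 = C 1, …`
    (C : ℕ → X → Matrix (QuantumWalk.CoinIndex d) (QuantumWalk.CoinIndex d) ℂ)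
    (hCmeas : ∀ k, Measurable (C k))
    (hCindep : iIndepFun C ν)
    (hCident : ∀ k, IdentDistrib (C k) (C 0) ν ν)
    -- their permutation parts
    (π : ℕ → X → Equiv.Perm (QuantumWalk.CoinIndex d))
    (hπ : ∀ k ω, ∃ Θ : QuantumWalk.CoinIndex d → ℝ, C k ω = QuantumWalk.phasedPerm (π k ω) Θ)
    -- the initial coin state and the initial point of the path
    (φ₀ : EuclideanSpace ℂ (QuantumWalk.CoinIndex d)) (hφ₀ : ‖φ₀‖ = 1)
    (τ₀ : X → QuantumWalk.CoinIndex d) (hτ₀meas : Measurable τ₀)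
    (hτ₀law : ∀ σ, ν.real {ω | τ₀ ω = σ} = ‖φ₀ σ‖ ^ 2)
    (hτ₀indep : IndepFun τ₀ (fun ω k => C k ω) ν)
    (hirr : (QuantumWalk.transitionMatrix ν (C 0)).IsIrreducible) :
    -- `P` is doubly stochastic and is the expectation of the transposed permutation matrices
    QuantumWalk.transitionMatrix ν (C 0) ∈ doublyStochastic ℝ (QuantumWalk.CoinIndex d) ∧
    (∀ k σ' σ, ((QuantumWalk.transitionMatrix ν (C 0) σ' σ : ℝ) : ℂ)
      = ∫ ω, (QuantumWalk.phasedPerm (π k ω) 0)ᵀ σ' σ ∂ν) ∧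
    -- the coin path is a Markov chain with finite state space
    QuantumWalk.IsMarkovChain ν (QuantumWalk.coinPath τ₀ π) (fun σ => ‖φ₀ σ‖ ^ 2)
      (QuantumWalk.transitionMatrix ν (C 0)) ∧
    -- law of large numbers
    (∀ᵐ ω ∂ν, Tendsto
      (fun n : ℕ => (1 / (n : ℝ)) •
        ∑ j ∈ Finset.Icc 1 n, QuantumWalk.jumpVec r (QuantumWalk.coinPath τ₀ π j ω))
      atTop (𝓝 (QuantumWalk.drift r))) ∧
    -- the reduced resolvent is well defined
    IsUnit (QuantumWalk.projQ d * QuantumWalk.transitionMatrix ν (C 0) * QuantumWalk.projQ d - 1) ∧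
    (QuantumWalk.transitionMatrix ν (C 0) - 1)
        * QuantumWalk.reducedResolvent (QuantumWalk.transitionMatrix ν (C 0))
      = QuantumWalk.projQ d ∧
    QuantumWalk.reducedResolvent (QuantumWalk.transitionMatrix ν (C 0))
        * (QuantumWalk.transitionMatrix ν (C 0) - 1)
      = QuantumWalk.projQ d ∧
    -- the covariance matrix, and the central limit theorem
    (QuantumWalk.covMatrix r (QuantumWalk.transitionMatrix ν (C 0))).PosSemidef ∧
    TendstoInDistribution
      (fun (n : ℕ) (ω : X) => (1 / √(n : ℝ)) •
        ∑ j ∈ Finset.Icc 1 n,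
          (QuantumWalk.jumpVec r (QuantumWalk.coinPath τ₀ π j ω) - QuantumWalk.drift r))
      atTop (id : EuclideanSpace ℝ (Fin d) → EuclideanSpace ℝ (Fin d)) (fun _ => ν)
      (multivariateGaussian 0 (QuantumWalk.covMatrix r (QuantumWalk.transitionMatrix ν (C 0)))) := by
  have hds := QuantumWalk.transitionMatrix_mem_doublyStochastic (ν := ν) (hCmeas 0) (hπ 0)
  have hchain := QuantumWalk.isMarkovChain_coinPath hCmeas hCindep hCident hπ hτ₀meas hτ₀indep
  rw [funext hτ₀law] at hchain
  refine ⟨hds, fun k σ' σ => ?_, hchain, ?_,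
    QuantumWalk.isUnit_projQ_compression_sub_one hds hirr,
    QuantumWalk.sub_one_mul_reducedResolvent hds hirr,
    QuantumWalk.reducedResolvent_mul_sub_one hds hirr,
    QuantumWalk.posSemidef_covMatrix r hds hirr, ?_⟩
  · rw [QuantumWalk.integral_phasedPerm_zero_transpose (hCmeas k) (hπ k),
      QuantumWalk.transitionMatrix_eq_of_identDistrib (hCident k)]
  · rw [QuantumWalk.drift_eq]
    exact hchain.ae_tendsto_average hds hirr (QuantumWalk.jumpVec r)
  · exact hchain.tendstoInDistribution_sum_jumpVec r hds hirr
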